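/- Let $\lambda,\mu>0$, $\rho\in\mathbb R$, $q\neq 0$, $\tau=\frac1\lambda+\frac1\mu$, and let $\sigma^{+-},\sigma^{-+}:[0,1]\to\mathbb R$ be bounded and Borel measurable. Consider the system $$u_t+\lambda u_x=\sigma^{+-}(x)v,\quad v_t-\mu v_x=\sigma^{-+}(x)u,\quad u(t,0)=q\,v(t,0),\quad v(t,1)=\rho\,u(t,1)+U(t),\qquad x\in[0,1].$$ Let $K^{uu},K^{uv},K^{vu},K^{vv}$ be bounded measurable functions on $\mathcal T=\{0\le\xi\le x\le1\}$ that solve, in the sense of integration along characteristics, $$\lambda K^{uu}_x+\lambda K^{uu}_\xi=-K^{uv}\sigma^{-+}(\xi),\quad \lambda K^{uv}_x-\mu K^{uv}_\xi=-K^{uu}\sigma^{+-}(\xi),$$ $$\mu K^{vu}_x-\lambda K^{vu}_\xi=K^{vv}\sigma^{-+}(\xi),\quad \mu K^{vv}_x+\mu K^{vv}_\xi=K^{vu}\sigma^{+-}(\xi),$$ $$K^{vu}(x,x)=-\tfrac{\sigma^{-+}(x)}{\lambda+\mu},\quad K^{vv}(x,0)=\tfrac{\lambda q}{\mu}K^{vu}(x,0),\quad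 K^{uv}(x,x)=\tfrac{\sigma^{+-}(x)}{\lambda+\mu},\quad K^{uv}(x,0)=\tfrac{\lambda q}{\mu}K^{uu}(x,0),$$ and let $L^{\alpha\alpha},L^{\alpha\beta},L^{\beta\alpha},L^{\beta\beta}$ be the bounded measurable kernels on $\mathcal T$ of the inverse of the transformation $$\alpha(x)=u(x)-\int_0^x\big(K^{uu}(x,\xi)u(\xi)+K^{uv}(x,\xi)v(\xi)\big)d\xi,\quad \beta(x)=v(x)-\int_0^x\big(K^{vu}(x,\xi)u(\xi)+K^{vv}(x,\xi)v(\xi)\big)d\xi,$$ that is, for square integrable profiles and every $x\in[0,1]$, this transformation and $$u(x)=\alpha(x)+\int_0^x\big(L^{\alpha\alpha}(x,\xi)\alpha(\xi)+L^{\alpha\beta}(x,\xi)\beta(\xi)\big)d\xi,\quad v(x)=\beta(x)+\int_0^x\big(L^{\beta\alpha}(x,\xi)\alpha(\xi)+L^{\beta\beta}(x,\xi)\beta(\xi)\big)d\xi$$ are inverse to each other. Put $N^\alpha(\xi)=L^{\beta\alpha}(1,\xi)-\rho L^{\alpha\alpha}(1,\xi)$, $N^\beta(\xi)=L^{\beta\beta}(1,\xi)-\rho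 L^{\alpha\beta}(1,\xi)$ and $$\tilde N(\nu)=q\lambda\,N^\alpha\big(\lambda\nu-\tfrac\lambda\mu\big)\mathbf 1_{[1/\mu,\tau]}(\nu)+\mu\,N^\beta(1-\mu\nu)\mathbf 1_{[0,1/\mu]}(\nu).$$ If $|\rho q|>1$, then the open-loop transfer function of the transformed system from the input to $\beta(\cdot,1)$, $$H_1(s)=\frac{1}{1-\rho q\,e^{-\tau s}+\int_0^\tau\tilde N(\xi)e^{-\xi s}\,d\xi},$$ has infinitely many poles $s\in\mathbb C$ with $\operatorname{Re}s>0$. -/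

import Mathlib

open MeasureTheory Set

namespace CoupledHyperbolic

/-- The triangle of all `(x, ξ)` with `0 ≤ ξ ≤ x ≤ 1`. -/
def triangle : Set (ℝ × ℝ) := {p | 0 ≤ p.2 ∧ p.2 ≤ p.1 ∧ p.1 ≤ 1}

/-- A `2 × 2` matrix of Volterra kernels; only the values on `triangle` matter. For the direct
transformation the entries are `K^{uu}, K^{uv}, K^{vu}, K^{vv}`; for the inverse one they are
`L^{αα}, L^{αβ}, L^{βα}, L^{ββ}`, in the same order. -/
structure Kernels where
  uu : ℝ → ℝ → ℝ
  uv : ℝ → ℝ → ℝ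
  vu : ℝ → ℝ → ℝ
  vv : ℝ → ℝ → ℝ

/-- `k` is a bounded (Borel) measurable function on `triangle`. -/
def BddMeasOnTriangle (k : ℝ → ℝ → ℝ) : Prop :=
  Measurable (fun p : triangle => k p.1.1 p.1.2) ∧
    ∃ C : ℝ, ∀ p ∈ triangle, |k p.1 p.2| ≤ C

/-- All four entries are bounded measurable functions on `triangle`. -/
structure Kernels.BddMeas (K : Kernels) : Prop where
  uu : BddMeasOnTriangle K.uu
  uv : BddMeasOnTriangle K.uv
  vu : BddMeasOnTriangle K.vu
  vv : BddMeasOnTriangle K.vv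

/-- `a k_x + b k_ξ = g` on `triangle`, in the sense of integration along characteristics: on every
segment of direction `(a, b)` inside the (convex) triangle, `k` is the integral of `g`. For
functions that are only bounded and measurable this is the usual meaning of such an equation
when boundary values are prescribed pointwise. -/
def SolvesTransport (a b : ℝ) (k g : ℝ → ℝ → ℝ) : Prop :=
  ∀ x ξ h : ℝ, 0 ≤ h → (x, ξ) ∈ triangle → (x + a * h, ξ + b * h) ∈ triangle →
    k (x + a * h) (ξ + b * h) - k x ξ = ∫ r in (0 : ℝ)..h, g (x + a * r) (ξ + b * r)

/-- `K` is the (bounded measurable) solution of the kernel equations of the system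
`u_t + lam u_x = σpm v`, `v_t - mu v_x = σmp u`, `u(t,0) = q v(t,0)`. -/
structure IsBacksteppingKernel (lam mu q : ℝ) (σpm σmp : ℝ → ℝ) (K : Kernels) : Prop where
  bddMeas : K.BddMeas
  pde_uu : SolvesTransport lam lam K.uu (fun x ξ => -(K.uv x ξ * σmp ξ))
  pde_uv : SolvesTransport lam (-mu) K.uv (fun x ξ => -(K.uu x ξ * σpm ξ))
  pde_vu : SolvesTransport mu (-lam) K.vu (fun x ξ => K.vv x ξ * σmp ξ)
  pde_vv : SolvesTransport mu mu K.vv (fun x ξ => K.vu x ξ * σpm ξ)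
  diag_vu : ∀ x ∈ Icc (0 : ℝ) 1, K.vu x x = -(σmp x / (lam + mu))
  bdry_vv : ∀ x ∈ Icc (0 : ℝ) 1, K.vv x 0 = lam * q / mu * K.vu x 0
  diag_uv : ∀ x ∈ Icc (0 : ℝ) 1, K.uv x x = σpm x / (lam + mu)
  bdry_uv : ∀ x ∈ Icc (0 : ℝ) 1, K.uv x 0 = lam * q / mu * K.uu x 0

/-- First component of the Volterra integral operator with kernel `K`, applied to `(f, g)`. -/
noncomputable def Kernels.int₁ (K : Kernels) (f g : ℝ → ℝ) (x : ℝ) : ℝ :=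
  ∫ ξ in (0 : ℝ)..x, (K.uu x ξ * f ξ + K.uv x ξ * g ξ)

/-- Second component of the Volterra integral operator with kernel `K`, applied to `(f, g)`. -/
noncomputable def Kernels.int₂ (K : Kernels) (f g : ℝ → ℝ) (x : ℝ) : ℝ :=
  ∫ ξ in (0 : ℝ)..x, (K.vu x ξ * f ξ + K.vv x ξ * g ξ)

/-- `f` is square integrable on `[0,1]`. -/
def SqInt (f : ℝ → ℝ) : Prop := MemLp f 2 (volume.restrict (Icc (0 : ℝ) 1))

/-- `L` is the kernel of the inverse transformation: for square integrable pairs on `[0,1]`,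
`(α, β) = (u, v) - ∫ K (u, v)` and `(u, v) = (α, β) + ∫ L (α, β)` are mutually inverse. The
identities are required at every `x ∈ [0,1]`, so that `L(x, ·)` is determined almost everywhere
for every `x`, in particular for `x = 1`. -/
structure IsInverseKernel (K L : Kernels) : Prop where
  bddMeas : L.BddMeas
  left_inv : ∀ u v α β : ℝ → ℝ, SqInt u → SqInt v →
    (∀ x ∈ Icc (0 : ℝ) 1, α x = u x - K.int₁ u v x ∧ β x = v x - K.int₂ u v x) →
    ∀ x ∈ Icc (0 : ℝ) 1, u x = α x + L.int₁ α β x ∧ v x = β x + L.int₂ α β x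
  right_inv : ∀ u v α β : ℝ → ℝ, SqInt α → SqInt β →
    (∀ x ∈ Icc (0 : ℝ) 1, u x = α x + L.int₁ α β x ∧ v x = β x + L.int₂ α β x) →
    ∀ x ∈ Icc (0 : ℝ) 1, α x = u x - K.int₁ u v x ∧ β x = v x - K.int₂ u v x

/-- The characteristic time `τ = 1/lam + 1/mu`. -/
noncomputable def charTime (lam mu : ℝ) : ℝ := 1 / lam + 1 / mu

/-- `N^α(ξ) = L^{βα}(1,ξ) - ρ L^{αα}(1,ξ)`. -/
def Nα (ρ : ℝ) (L : Kernels) (ξ : ℝ) : ℝ := L.vu 1 ξ - ρ * L.uu 1 ξ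

/-- `N^β(ξ) = L^{ββ}(1,ξ) - ρ L^{αβ}(1,ξ)`. -/
def Nβ (ρ : ℝ) (L : Kernels) (ξ : ℝ) : ℝ := L.vv 1 ξ - ρ * L.uv 1 ξ

/-- The distributed-delay kernel `Ñ` on `[0, τ]`. The factor `q` comes from
`α(t,x) = q β(t - x/lam - 1/mu, 1)`. -/
noncomputable def Ntilde (lam mu ρ q : ℝ) (L : Kernels) (ν : ℝ) : ℝ :=
  (Icc (1 / mu) (charTime lam mu)).indicator
      (fun ν => q * lam * Nα ρ L (lam * ν - lam / mu)) ν
    + (Icc 0 (1 / mu)).indicator (fun ν => mu * Nβ ρ L (1 - mu * ν)) ν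

/-- The open-loop transfer function `H₁` from `U₀` to `β(·,1)`. -/
noncomputable def H₁ (lam mu ρ q : ℝ) (L : Kernels) (s : ℂ) : ℂ :=
  1 / (1 - (ρ * q : ℝ) * Complex.exp (-((charTime lam mu : ℝ) * s))
    + ∫ ξ in (0 : ℝ)..charTime lam mu,
        (Ntilde lam mu ρ q L ξ : ℂ) * Complex.exp (-((ξ : ℂ) * s)))

/-- `s` is a pole of `f`: `f` is meromorphic at `s` and has negative order there. -/
def IsPole (f : ℂ → ℂ) (s : ℂ) : Prop := MeromorphicAt f s ∧ meromorphicOrderAt f s < 0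

end CoupledHyperbolic

/-! Write the denominator of `H₁` as `G(s) + P(s)` with `G(s) = 1 - a e^{-Ts}`, `a = ρq`, `T = τ`,
and `P` the Laplace transform of `Ñ`. `G` has period `2πi/T` and, since `|a| > 1`, the zero `log a /
T` in the right half-plane. By Riemann-Lebesgue, `P` tends to 0, uniformly on compact sets, under
translation by `2πik/T`. Hence for large `k` the denominator has a zero close to `log a / T +
2πik/T`, by a quantitative open mapping theorem in the role of Rouché's (`exists_zero_delayChar`).
These zeros have unbounded imaginary parts, and each is isolated, hence a pole of `H₁`. The kernels
enter through the integrability of `Ñ`. -/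

/-! ### Finite Laplace transforms in the right half-plane -/

/-- The Laplace transform of a function supported on `[0, T]`. -/
noncomputable def finiteLaplace (n : ℝ → ℂ) (T : ℝ) (s : ℂ) : ℂ :=
  ∫ ξ in (0 : ℝ)..T, n ξ * Complex.exp (-((ξ : ℂ) * s))

theorem norm_exp_neg_mul_le_one {ξ : ℝ} (hξ : 0 ≤ ξ) {s : ℂ} (hs : 0 ≤ s.re) :
    ‖Complex.exp (-((ξ : ℂ) * s))‖ ≤ 1 := by
  rw [Complex.norm_exp, Real.exp_le_one_iff]
  simp only [Complex.neg_re, Complex.re_ofReal_mul, Left.neg_nonpos_iff]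
  positivity

theorem isOpen_re_pos : IsOpen {s : ℂ | 0 < s.re} := isOpen_lt continuous_const Complex.continuous_re

theorem hasDerivAt_finiteLaplace {n : ℝ → ℂ} {T : ℝ} (hT : 0 < T)
    (hn : IntervalIntegrable n volume 0 T) {s : ℂ} (hs : 0 < s.re) :
    HasDerivAt (finiteLaplace n T)
      (∫ ξ in (0 : ℝ)..T, n ξ * (Complex.exp (-((ξ : ℂ) * s)) * -(ξ : ℂ))) s := by
  have hF : ∀ z : ℂ, IntervalIntegrable (fun ξ : ℝ => n ξ * Complex.exp (-((ξ : ℂ) * z)))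
      volume 0 T := fun z => hn.mul_continuousOn (by fun_prop)
  have hF' : IntervalIntegrable (fun ξ : ℝ => n ξ * (Complex.exp (-((ξ : ℂ) * s)) * -(ξ : ℂ)))
      volume 0 T := hn.mul_continuousOn (by fun_prop)
  refine (intervalIntegral.hasDerivAt_integral_of_dominated_loc_of_deriv_le
    (F := fun s ξ => n ξ * Complex.exp (-((ξ : ℂ) * s)))
    (F' := fun s ξ => n ξ * (Complex.exp (-((ξ : ℂ) * s)) * -(ξ : ℂ)))
    (bound := fun ξ => ‖n ξ‖ * T)
    (isOpen_re_pos.mem_nhds hs) (Filter.Eventually.of_forall fun z => ?_) ?_ ?_ ?_ ?_ ?_).2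
  · exact (intervalIntegrable_iff.1 (hF z)).aestronglyMeasurable
  · exact hF s
  · exact (intervalIntegrable_iff.1 hF').aestronglyMeasurable
  · refine Filter.Eventually.of_forall fun ξ hξ z hz => ?_
    rw [uIoc_of_le hT.le] at hξ
    rw [norm_mul, norm_mul, norm_neg, Complex.norm_of_nonneg hξ.1.le]
    gcongr
    calc _ ≤ 1 * ξ := by
          gcongr
          · exact hξ.1.le
          · exact norm_exp_neg_mul_le_one hξ.1.le (le_of_lt hz)
      _ ≤ T := by linarith [hξ.2]
  · exact hn.norm.mul_const T
  · refine Filter.Eventually.of_forall fun ξ _ z _ => ?_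
    have h : HasDerivAt (fun z : ℂ => -((ξ : ℂ) * z)) (-(ξ : ℂ)) z := by
      simpa using ((hasDerivAt_id z).const_mul (ξ : ℂ)).fun_neg
    exact h.cexp.const_mul _

/-- Mean value inequality on the convex half-plane. The Lipschitz constant does not depend on the
imaginary part, so it serves all vertical translates at once. -/
theorem norm_finiteLaplace_sub_le {n : ℝ → ℂ} {T : ℝ} (hT : 0 < T)
    (hn : IntervalIntegrable n volume 0 T) {z w : ℂ} (hz : 0 < z.re) (hw : 0 < w.re) :
    ‖finiteLaplace n T w - finiteLaplace n T z‖ ≤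
      (∫ ξ in (0 : ℝ)..T, ‖n ξ‖ * T) * ‖w - z‖ := by
  refine (convex_halfSpace_re_gt 0).norm_image_sub_le_of_norm_hasDerivWithin_le
    (fun s hs => (hasDerivAt_finiteLaplace hT hn hs).hasDerivWithinAt) (fun s hs => ?_) hz hw
  refine intervalIntegral.norm_integral_le_of_norm_le hT.le
    (Filter.Eventually.of_forall fun ξ hξ => ?_) (hn.norm.mul_const T)
  rw [norm_mul, norm_mul, norm_neg, Complex.norm_of_nonneg hξ.1.le]
  gcongr
  calc _ ≤ 1 * ξ := by
        gcongr
        · exact hξ.1.le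
        · exact norm_exp_neg_mul_le_one hξ.1.le (le_of_lt hs)
    _ ≤ T := by linarith [hξ.2]

/-- Riemann-Lebesgue along vertical translates by multiples of `2πi / T`. -/
theorem tendsto_finiteLaplace_add {n : ℝ → ℂ} {T : ℝ} (hT : 0 < T) (s : ℂ) :
    Filter.Tendsto (fun k : ℕ => finiteLaplace n T (s + (2 * Real.pi * k / T : ℝ) * Complex.I))
      Filter.atTop (nhds 0) := by
  -- The factor `e^{-ξs}` is absorbed into the function; the translation becomes the Fourier
  -- character at frequency `k / T`. A nonintegrable function has integral 0 by convention, so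
  -- integrability need not be assumed.
  have h := Real.tendsto_integral_exp_smul_cocompact
    ((Ioc 0 T).indicator fun ξ : ℝ => n ξ * Complex.exp (-((ξ : ℂ) * s)))
  have hk : Filter.Tendsto (fun k : ℕ => (k : ℝ) / T) Filter.atTop (Filter.cocompact ℝ) :=
    (tendsto_natCast_atTop_atTop.atTop_div_const hT).mono_right atTop_le_cocompact
  refine (h.comp hk).congr fun k => ?_
  simp only [Function.comp_apply, finiteLaplace]
  rw [intervalIntegral.integral_of_le hT.le, ← integral_indicator measurableSet_Ioc]
  congr 1
  ext ξ
  by_cases hξ : ξ ∈ Ioc 0 T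
  · rw [indicator_of_mem hξ, indicator_of_mem hξ, Circle.smul_def, Real.fourierChar_apply,
      smul_eq_mul, mul_left_comm, ← Complex.exp_add]
    congr 2
    push_cast
    ring
  · simp [hξ]

/-- The translates are equi-Lipschitz, so pointwise convergence is locally uniform. -/
theorem tendstoUniformlyOn_finiteLaplace_add {n : ℝ → ℂ} {T : ℝ} (hT : 0 < T)
    (hn : IntervalIntegrable n volume 0 T) {S : Set ℂ} (hS : IsCompact S)
    (hSre : S ⊆ {s | 0 < s.re}) :
    TendstoUniformlyOn
      (fun (k : ℕ) s => finiteLaplace n T (s + (2 * Real.pi * k / T : ℝ) * Complex.I))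
      0 Filter.atTop S := by
  rw [← tendstoLocallyUniformlyOn_iff_tendstoUniformlyOn_of_compact hS,
    Metric.tendstoLocallyUniformlyOn_iff]
  intro ε hε z hz
  set C := ∫ ξ in (0 : ℝ)..T, ‖n ξ‖ * T
  have hC : Filter.Tendsto (fun w : ℂ => C * ‖w - z‖) (nhds z) (nhds 0) := by
    have : Continuous fun w : ℂ => C * ‖w - z‖ := by fun_prop
    simpa using this.tendsto z
  refine ⟨S ∩ {w | C * ‖w - z‖ < ε / 2}, Filter.inter_mem self_mem_nhdsWithin
    (mem_nhdsWithin_of_mem_nhds (hC.eventually_lt_const (half_pos hε))), ?_⟩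
  have hlim := (tendsto_finiteLaplace_add (n := n) hT z).norm
  rw [norm_zero] at hlim
  filter_upwards [hlim.eventually_lt_const (half_pos hε)] with k hk w hw
  have h := norm_finiteLaplace_sub_le hT hn
    (z := z + (2 * Real.pi * k / T : ℝ) * Complex.I)
    (w := w + (2 * Real.pi * k / T : ℝ) * Complex.I)
    (by simpa using hSre hz) (by simpa using hSre hw.1)
  rw [add_sub_add_right_eq_sub] at h
  have hw2 : C * ‖w - z‖ < ε / 2 := hw.2
  rw [Pi.zero_apply, dist_zero_left]
  have := norm_sub_norm_le (finiteLaplace n T (w + (2 * Real.pi * k / T : ℝ) * Complex.I))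
    (finiteLaplace n T (z + (2 * Real.pi * k / T : ℝ) * Complex.I))
  linarith

/-! ### Zeros of the characteristic function -/

/-- The characteristic function `1 - a e^{-Ts} + ∫₀ᵀ n(ξ) e^{-ξs} dξ`. -/
noncomputable def delayChar (n : ℝ → ℂ) (T : ℝ) (a s : ℂ) : ℂ :=
  1 - a * Complex.exp (-(T * s)) + finiteLaplace n T s

theorem analyticOnNhd_delayChar {n : ℝ → ℂ} {T : ℝ} (hT : 0 < T)
    (hn : IntervalIntegrable n volume 0 T) (a : ℂ) :
    AnalyticOnNhd ℂ (delayChar n T a) {s | 0 < s.re} := by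
  refine DifferentiableOn.analyticOnNhd (fun s hs => ?_) isOpen_re_pos
  have h := (hasDerivAt_finiteLaplace hT hn hs).differentiableAt
  exact DifferentiableAt.differentiableWithinAt (by unfold delayChar; fun_prop)

theorem AnalyticOnNhd.frequently_ne_of_ne {f : ℂ → ℂ} {U : Set ℂ} (hf : AnalyticOnNhd ℂ f U)
    (hU : IsPreconnected U) {z w : ℂ} (hz : z ∈ U) (hw : w ∈ U) (h : f w ≠ f z) :
    ∃ᶠ x in nhds z, f x ≠ f z := by
  intro hev
  simp only [not_not] at hev
  exact h (hf.eqOn_of_preconnected_of_eventuallyEq analyticOnNhd_const hU hz hev hw)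

theorem exists_zero_delayChar {n : ℝ → ℂ} {T : ℝ} (hT : 0 < T)
    (hn : IntervalIntegrable n volume 0 T) {a : ℂ} (ha : 1 < ‖a‖) (M : ℝ) :
    ∃ s : ℂ, 0 < s.re ∧ M < s.im ∧ delayChar n T a s = 0 ∧
      ∃ᶠ z in nhds s, delayChar n T a z ≠ 0 := by
  have hT' : (T : ℂ) ≠ 0 := by exact_mod_cast hT.ne'
  have ha0 : a ≠ 0 := by
    rintro rfl
    norm_num at ha
  set H : Set ℂ := {s | 0 < s.re}
  set s₀ : ℂ := Complex.log a / T with hs₀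
  have hs₀re : 0 < s₀.re := by
    rw [hs₀, Complex.div_ofReal_re, Complex.log_re]
    exact div_pos (Real.log_pos ha) hT
  -- The first bound keeps the disc in the half-plane; the second gives `T * r ≤ 1 < 2π`, so no
  -- other zero of `G` lies on the circle.
  set r : ℝ := min (s₀.re / 2) (1 / T) with hr
  have hr0 : 0 < r := lt_min (half_pos hs₀re) (by positivity)
  have hball : Metric.closedBall s₀ r ⊆ H := by
    intro z hz
    have h1 := (Complex.abs_re_le_norm (z - s₀)).trans (mem_closedBall_iff_norm.1 hz)
    have h2 : r ≤ s₀.re / 2 := min_le_left _ _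
    rw [Complex.sub_re, abs_le] at h1
    change 0 < z.re
    linarith
  set G : ℂ → ℂ := fun s => 1 - a * Complex.exp (-(T * s)) with hG
  have hGexp : ∀ s, G s = 1 - Complex.exp (-(T * (s - s₀))) := by
    intro s
    have : -((T : ℂ) * (s - s₀)) = Complex.log a + -(T * s) := by
      rw [hs₀]
      field_simp
      ring
    rw [this, Complex.exp_add, Complex.exp_log ha0]
  have hG₀ : G s₀ = 0 := by simp [hGexp]
  have hGne : ∀ z ∈ Metric.sphere s₀ r, G z ≠ 0 := by
    intro z hz h0
    rw [mem_sphere_iff_norm] at hz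
    rw [hGexp, sub_eq_zero, eq_comm, Complex.exp_eq_one_iff] at h0
    obtain ⟨m, hm⟩ := h0
    have hnorm := congrArg norm hm
    have hI : ‖(m : ℂ) * (2 * Real.pi * Complex.I)‖ = |(m : ℝ)| * (2 * Real.pi) := by
      rw [norm_mul, norm_mul, norm_mul, Complex.norm_I, Complex.norm_intCast, Complex.norm_real,
        Real.norm_of_nonneg Real.pi_pos.le]
      norm_num
    rw [hI, norm_neg, norm_mul, hz, Complex.norm_of_nonneg hT.le] at hnorm
    have h1 : T * r ≤ 1 := by
      calc T * r ≤ T * (1 / T) := by gcongr; exact min_le_right _ _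
        _ = 1 := by field_simp
    have h2 : 0 < T * r := by positivity
    have hm0 : m ≠ 0 := by
      rintro rfl
      simp at hnorm
      rcases hnorm with h | h <;> linarith
    have h3 : (1 : ℝ) ≤ |(m : ℝ)| := by exact_mod_cast Int.one_le_abs hm0
    nlinarith [Real.pi_gt_three]
  have hGcont : Continuous G := by fun_prop
  obtain ⟨ε, hε, hGε⟩ : ∃ ε > 0, ∀ z ∈ Metric.sphere s₀ r, ε ≤ ‖G z‖ := by
    obtain ⟨y, hy, hmin⟩ := (isCompact_sphere s₀ r).exists_isMinOn
      (NormedSpace.sphere_nonempty.2 hr0.le) hGcont.norm.continuousOn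
    exact ⟨‖G y‖, norm_pos_iff.2 (hGne y hy), fun z hz => hmin hz⟩
  have hunif := Metric.tendstoUniformlyOn_iff.1
    (tendstoUniformlyOn_finiteLaplace_add hT hn (isCompact_closedBall s₀ r) hball)
    (ε / 4) (by positivity)
  have hlarge : ∀ᶠ k : ℕ in Filter.atTop, M + r - s₀.im < 2 * Real.pi * k / T :=
    ((tendsto_natCast_atTop_atTop.const_mul_atTop Real.two_pi_pos).atTop_div_const
      hT).eventually_gt_atTop _
  obtain ⟨k, hk, hkM⟩ := (hunif.and hlarge).exists
  set c : ℂ := (2 * Real.pi * k / T : ℝ) * Complex.I with hc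
  have hcre : c.re = 0 := by simp [hc]
  have hcim : c.im = 2 * Real.pi * k / T := by simp [hc]
  have hmem : ∀ z, z + c ∈ H ↔ z ∈ H := fun z => by simp [H, hcre]
  have hP : ∀ z ∈ Metric.closedBall s₀ r, ‖finiteLaplace n T (z + c)‖ < ε / 4 := by
    intro z hz
    simpa [dist_zero_left] using hk z hz
  have hF : ∀ z, delayChar n T a (z + c) = G z + finiteLaplace n T (z + c) := by
    intro z
    have h1 : -((T : ℂ) * (z + c)) = -(T * z) - k * (2 * Real.pi * Complex.I) := by
      rw [hc]
      push_cast
      field_simp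
      ring
    rw [delayChar, h1, Complex.exp_periodic.sub_nat_mul_eq]
  have hsphere : ∀ z ∈ Metric.sphere s₀ r, ε - ε / 4 < ‖delayChar n T a (z + c)‖ := by
    intro z hz
    rw [hF]
    have h1 := hP z (Metric.sphere_subset_closedBall hz)
    have h2 := norm_sub_le_norm_add (G z) (finiteLaplace n T (z + c))
    linarith [hGε z hz]
  have hcenter : ‖delayChar n T a (s₀ + c)‖ < ε / 4 := by
    rw [hF, hG₀, zero_add]
    exact hP _ (Metric.mem_closedBall_self hr0.le)
  have hana := analyticOnNhd_delayChar hT hn a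
  have hanac : AnalyticOnNhd ℂ (fun z => delayChar n T a (z + c)) H := fun z hz =>
    (hana (z + c) ((hmem z).2 hz)).comp_of_eq (f := fun z => z + c) (by fun_prop) rfl
  have hpre : IsPreconnected H := (convex_halfSpace_re_gt 0).isPreconnected
  obtain ⟨y, hy⟩ := NormedSpace.sphere_nonempty (x := s₀).2 hr0.le
  have hyH := hball (Metric.sphere_subset_closedBall hy)
  have hs₀H : s₀ ∈ H := hs₀re
  have hy' := hsphere y hy
  -- On the circle, values differ from the central one by at least `ε - ε/4 - ε/4 = ε/2`, so the
  -- image contains the disc of radius `ε/4` about the central value, and 0 lies in it.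
  have himage := DiffContOnCl.ball_subset_image_closedBall (ε := ε / 2)
    (f := fun z => delayChar n T a (z + c)) (z₀ := s₀) (r := r)
    (DifferentiableOn.diffContOnCl
      (hanac.differentiableOn.mono (by rwa [closure_ball _ hr0.ne']))) hr0
    (fun z hz => by
      have h1 := hsphere z hz
      have h2 := norm_sub_norm_le (delayChar n T a (z + c)) (delayChar n T a (s₀ + c))
      linarith)
    (hanac.frequently_ne_of_ne hpre hs₀H hyH (fun h => by
      rw [h] at hy'
      linarith))
  obtain ⟨z, hz, hz0⟩ := himage (show (0 : ℂ) ∈ _ by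
    rw [Metric.mem_ball, dist_zero_left]
    linarith)
  have hz0' : delayChar n T a (z + c) = 0 := hz0
  refine ⟨z + c, (hmem z).2 (hball hz), ?_, hz0', ?_⟩
  · have h1 := (Complex.abs_im_le_norm (z - s₀)).trans (mem_closedBall_iff_norm.1 hz)
    rw [Complex.sub_im, abs_le] at h1
    rw [Complex.add_im, hcim]
    linarith
  · have h := hana.frequently_ne_of_ne hpre ((hmem z).2 (hball hz)) ((hmem y).2 hyH) (by
      rw [hz0', ← norm_pos_iff]
      linarith)
    rwa [hz0'] at h

/-! ### From zeros to poles -/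

/-- Zeros of an analytic function that is not locally zero are isolated, so `1 / f` tends to
infinity there. -/
theorem AnalyticAt.isPole_one_div {f : ℂ → ℂ} {s : ℂ} (hf : AnalyticAt ℂ f s) (h0 : f s = 0)
    (hne : ∃ᶠ z in nhds s, f z ≠ 0) : CoupledHyperbolic.IsPole (fun z => 1 / f z) s := by
  have hmer : MeromorphicAt (fun z => 1 / f z) s := by
    simpa only [one_div] using hf.meromorphicAt.fun_inv
  refine ⟨hmer, (tendsto_cobounded_iff_meromorphicOrderAt_neg hmer).1 ?_⟩
  simp only [one_div]
  refine Filter.tendsto_inv₀_nhdsNE_zero.comp (tendsto_nhdsWithin_iff.2 ⟨?_, ?_⟩)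
  · simpa only [h0] using hf.continuousAt.tendsto.mono_left nhdsWithin_le_nhds
  · exact hf.eventually_eq_zero_or_eventually_ne_zero.resolve_left
      fun h => hne (h.mono fun z hz => not_not.2 hz)

/-! ### Integrability of `Ñ` -/

namespace CoupledHyperbolic

/-- The last row of a bounded measurable kernel, extended by zero, is bounded and measurable. -/
theorem BddMeasOnTriangle.row_one {k : ℝ → ℝ → ℝ} (hk : BddMeasOnTriangle k) :
    Measurable ((Icc (0 : ℝ) 1).indicator (k 1)) ∧
      ∃ C : ℝ, ∀ ξ, |(Icc (0 : ℝ) 1).indicator (k 1) ξ| ≤ C := by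
  obtain ⟨hm, C, hC⟩ := hk
  have hmem : ∀ ξ ∈ Icc (0 : ℝ) 1, ((1 : ℝ), ξ) ∈ triangle := fun ξ hξ => ⟨hξ.1, hξ.2, le_rfl⟩
  constructor
  · have h1 : Measurable fun ξ : Icc (0 : ℝ) 1 => k 1 ξ :=
      hm.comp (g := fun p : triangle => k p.1.1 p.1.2)
        (f := fun ξ : Icc (0 : ℝ) 1 => (⟨(1, ξ), hmem ξ ξ.2⟩ : triangle))
        ((measurable_const.prodMk measurable_subtype_coe).subtype_mk)
    refine measurable_of_restrict_of_restrict_compl measurableSet_Icc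
      (s := Icc (0 : ℝ) 1) ?_ ?_
    · convert h1 using 2 with ξ
      exact indicator_of_mem ξ.2 _
    · convert (measurable_const : Measurable fun _ : ((Icc (0 : ℝ) 1)ᶜ : Set ℝ) => (0 : ℝ))
        using 2 with ξ
      exact indicator_of_notMem ξ.2 _
  · refine ⟨max C 0, fun ξ => ?_⟩
    by_cases hξ : ξ ∈ Icc (0 : ℝ) 1
    · rw [indicator_of_mem hξ]
      exact (hC _ (hmem ξ hξ)).trans (le_max_left _ _)
    · rw [indicator_of_notMem hξ, abs_zero]
      exact le_max_right _ _

/-- Pulling back the last row by an affine map and cutting off gives an integrable function. -/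
theorem BddMeasOnTriangle.intervalIntegrable_indicator {k : ℝ → ℝ → ℝ}
    (hk : BddMeasOnTriangle k) {I : Set ℝ} (hI : MeasurableSet I) {g : ℝ → ℝ} (hg : Measurable g)
    (hgI : MapsTo g I (Icc 0 1)) (a b : ℝ) :
    IntervalIntegrable (I.indicator fun ν => k 1 (g ν)) volume a b := by
  obtain ⟨hm, C, hC⟩ := hk.row_one
  have heq : (I.indicator fun ν => k 1 (g ν)) =
      I.indicator fun ν => (Icc (0 : ℝ) 1).indicator (k 1) (g ν) := by
    refine indicator_congr fun ν hν => ?_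
    rw [indicator_of_mem (hgI hν)]
  rw [heq]
  refine (intervalIntegrable_const (c := C)).mono_fun
    ((hm.comp hg).indicator hI).aestronglyMeasurable (Filter.Eventually.of_forall fun ν => ?_)
  refine (norm_indicator_le_norm_self _ _).trans ?_
  rw [Real.norm_eq_abs, Real.norm_eq_abs]
  exact (hC (g ν)).trans (le_abs_self C)

theorem intervalIntegrable_Ntilde {lam mu : ℝ} (hlam : 0 < lam) (hmu : 0 < mu) (ρ q : ℝ)
    {L : Kernels} (hL : L.BddMeas) (a b : ℝ) :
    IntervalIntegrable (Ntilde lam mu ρ q L) volume a b := by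
  have hα : MapsTo (fun ν => lam * ν - lam / mu) (Icc (1 / mu) (charTime lam mu)) (Icc 0 1) := by
    rintro ν ⟨h1, h2⟩
    have h3 := mul_le_mul_of_nonneg_left h1 hlam.le
    have h4 := mul_le_mul_of_nonneg_left h2 hlam.le
    have h5 : lam * charTime lam mu = 1 + lam / mu := by
      unfold charTime
      field_simp
    rw [mul_one_div] at h3
    constructor <;> linarith
  have hβ : MapsTo (fun ν => 1 - mu * ν) (Icc 0 (1 / mu)) (Icc 0 1) := by
    rintro ν ⟨h1, h2⟩
    have h3 := mul_le_mul_of_nonneg_left h2 hmu.le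
    rw [mul_one_div_cancel hmu.ne'] at h3
    have h4 := mul_nonneg hmu.le h1
    constructor <;> linarith
  have hgα : Measurable fun ν : ℝ => lam * ν - lam / mu := by fun_prop
  have hgβ : Measurable fun ν : ℝ => 1 - mu * ν := by fun_prop
  have h :=
    (((hL.vu.intervalIntegrable_indicator measurableSet_Icc hgα hα a b).sub
      ((hL.uu.intervalIntegrable_indicator measurableSet_Icc hgα hα a b).const_mul ρ)).const_mul
        (q * lam)).add
    (((hL.vv.intervalIntegrable_indicator measurableSet_Icc hgβ hβ a b).sub
      ((hL.uv.intervalIntegrable_indicator measurableSet_Icc hgβ hβ a b).const_mul ρ)).const_mul mu)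
  convert h using 1
  ext ν
  simp only [Ntilde, Nα, Nβ, indicator_apply]
  split_ifs <;> ring

end CoupledHyperbolic

/-! ### Conclusion -/

theorem mainTheorem6 (lam mu ρ q : ℝ) (hlam : 0 < lam) (hmu : 0 < mu)
    (σpm σmp : ℝ → ℝ) (K L : CoupledHyperbolic.Kernels)
    (hK : CoupledHyperbolic.IsBacksteppingKernel lam mu q σpm σmp K)
    (hL : CoupledHyperbolic.IsInverseKernel K L)
    (hρq : 1 < |ρ * q|) :
    {s : ℂ | 0 < s.re ∧
      CoupledHyperbolic.IsPole (CoupledHyperbolic.H₁ lam mu ρ q L) s}.Infinite := by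
  have hτ : 0 < CoupledHyperbolic.charTime lam mu := by
    unfold CoupledHyperbolic.charTime
    positivity
  have hn : IntervalIntegrable (fun ξ => (CoupledHyperbolic.Ntilde lam mu ρ q L ξ : ℂ)) volume 0
      (CoupledHyperbolic.charTime lam mu) := by
    have h := CoupledHyperbolic.intervalIntegrable_Ntilde hlam hmu ρ q hL.bddMeas 0
      (CoupledHyperbolic.charTime lam mu)
    exact ⟨h.1.ofReal, h.2.ofReal⟩
  have ha : 1 < ‖((ρ * q : ℝ) : ℂ)‖ := by rwa [Complex.norm_real]
  -- It suffices that the imaginary parts of the poles are unbounded above.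
  refine Infinite.of_image Complex.im (infinite_of_not_bddAbove ?_)
  rintro ⟨M, hM⟩
  obtain ⟨s, hs, hsM, hs0, hsne⟩ := exists_zero_delayChar hτ hn ha M
  exact hsM.not_ge (hM ⟨s, ⟨hs,
    (analyticOnNhd_delayChar hτ hn _ s hs).isPole_one_div hs0 hsne⟩, rfl⟩)
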